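/- Conventions. A multigraded ring is a commutative unital ring $S=\bigoplus_{d\in D}S_d$ graded by a finitely generated abelian group $D=D_S$ which is generated by its support $\{d : S_d\neq 0\}$. A morphism of multigraded rings $R\to S$ is a pair $(\varphi,\alpha)$ of a ring homomorphism $\varphi\colon R\to S$ and a group homomorphism $\alpha\colon D_R\to D_S$ with $\varphi(R_d)\subseteq S_{\alpha(d)}$ for all $d$. A homogeneous $f\in S$ is relevant if the group of degrees of homogeneous units of $S_f$ has finite index in $D$; $\mathrm{Rel}(S)$ is the set of relevant elements, and $S_+$ is the ideal generated by it. $S_{(f)}$ is the degree-zero part of $S_f$. A conical ring is a pair $(S,B)$ with $S$ a multigraded ring and $B\subseteq S_+$ a homogeneous ideal; $\mathrm{Rel}_B(S)=\mathrm{Rel}(S)\cap B$. The scheme $\mathrm{Proj}(S)$ is obtained by gluing the affine schemes $\mathrm{Spec}(S_{(f)})$, $f\in\mathrm{Rel}(S)$, where $\mathrm{Spec}(S_{(f)})$ and $\mathrm{Spec}(S_{(g)})$ are glued along their open subscheme $\mathrm{Spec}(S_{(fg)})$. For a set $A$ of relevant elements, $\bigcup_{f\in A}\mathrm{Spec}(S_{(f)})$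 denotes the corresponding open subscheme of $\mathrm{Proj}(S)$, and $\mathrm{Proj}_B(S)=\bigcup_{f\in\mathrm{Rel}_B(S)}\mathrm{Spec}(S_{(f)})$. A morphism of conical rings $(R,B_R)\to(S,B_S)$ is a morphism of multigraded rings $\varphi\colon R\to S$ such that every $f\in\mathrm{Rel}_{B_S}(S)$ is $\varphi(g)$ for some $g\in\mathrm{Rel}_{B_R}(R)$. With the evident composition, conical rings form a category $\mathbf{ConRing}$. A morphism of multigraded rings $\varphi\colon R\to S$ is rationally relevant on $(R,B_R)$ if for each $g\in\mathrm{Rel}_{B_R}(R)$ the element $\varphi(g)$ is relevant in the subring $\varphi(R)\subseteq S$, graded by $D_S$ with pieces $\varphi(R)\cap S_d$. A rational map $\Phi\colon(R,B_R)\dashrightarrow(S,B_S)$ of conical rings consists of a map $\varphi$ from $B_R$ to the set of homogeneous elements of $S$; for each $g\in\mathrm{Rel}_{B_R}(R)$ an element $f_g\in\mathrm{Rel}_{B_S}(S)$ such that $\varphi(g)\mid f_g$ and $S_{(\varphi(g))}=S_{(f_g)}$ (the canonical map is bijective); and ring homomorphisms $\varphi_g\colon R_{(g)}\to S_{(f_g)}$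 for $g\in\mathrm{Rel}_{B_R}(R)$ which are compatible on overlaps, that is, for all $g,g'$ there is a ring homomorphism $R_{(gg')}\to S_{(f_gf_{g'})}$ that is compatible with $\varphi_g$ and with $\varphi_{g'}$ under the canonical maps. Proposition. 1. For every conical ring $(S,B)$ the $\mathrm{Spec}(S_{(f)})$, $f\in\mathrm{Rel}_B(S)$, form an affine open cover of $\mathrm{Proj}_B(S)$, with $\mathrm{Spec}(S_{(f)})\cap\mathrm{Spec}(S_{(g)})=\mathrm{Spec}(S_{(fg)})$. If $G\subseteq\mathrm{Rel}_B(S)$ generates the same ideal as $\mathrm{Rel}_B(S)$, then $\mathrm{Proj}_B(S)=\bigcup_{f\in G}\mathrm{Spec}(S_{(f)})$. If $S$ is noetherian and factorially graded (it has no homogeneous zero divisors, and every homogeneous nonzero nonunit is a product of $D$-prime elements, i.e. of homogeneous nonzero nonunits $p$ such that $p\mid ab$ implies $p\mid a$ or $p\mid b$ for homogeneous $a,b$), then there is such a $G$ which is minimal with respect to inclusion and consists of products of $D$-prime elements. 2. There is a contravariant functor $\mathbf{Proj}\colon\mathbf{ConRing}\to\mathbf{Sch}$ with $(S,B)\mapsto\mathrm{Proj}_B(S)=\bigcup_{f\in\mathrm{Rel}_B(S)}\mathrm{Spec}(S_{(f)})$,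 which maps a morphism $\Phi\colon(R,B_R)\to(S,B_S)$ given by $\varphi$ to a morphism of schemes $\mathrm{Proj}_{B_S}(S)\to\mathrm{Proj}_{B_R}(R)$ that, for each $g\in\mathrm{Rel}_{B_R}(R)$ with $\varphi(g)\in\mathrm{Rel}_{B_S}(S)$, restricts on $\mathrm{Spec}(S_{(\varphi(g))})$ to the morphism to $\mathrm{Spec}(R_{(g)})$ induced by $R_{(g)}\to S_{(\varphi(g))}$. 3. Let $(R,B_R)$ and $(S,B_S)$ be conical rings and let $\varphi\colon R\to S$ be rationally relevant on $(R,B_R)$ (for example with $B_R=R_+$). Then $\varphi(g)$ is relevant in $S$ for all $g\in\mathrm{Rel}_{B_R}(R)$, and there is a unique morphism of schemes $$\bigcup_{f\in\varphi(\mathrm{Rel}_{B_R}(R))}\mathrm{Spec}(S_{(f)})\to\bigcup_{g\in\mathrm{Rel}_{B_R}(R)}\mathrm{Spec}(R_{(g)})=\mathrm{Proj}_{B_R}(R)$$ which for each $g\in\mathrm{Rel}_{B_R}(R)$ restricts to the morphism $\mathrm{Spec}(S_{(\varphi(g))})\to\mathrm{Spec}(R_{(g)})$ induced by $\varphi$.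 If $B_S$ is the ideal generated by $\varphi(B_R)$, then the source is $\mathrm{Proj}_{B_S}(S)$, so that there is a unique such morphism $\mathrm{Proj}_{B_S}(S)\to\mathrm{Proj}_{B_R}(R)$. 4. Let $\Phi\colon(R,B_R)\dashrightarrow(S,B_S)$ be a rational map of conical rings. Then there is a unique morphism of schemes $$\bigcup_{g\in\mathrm{Rel}_{B_R}(R)}\mathrm{Spec}(S_{(f_g)})\to\bigcup_{g\in\mathrm{Rel}_{B_R}(R)}\mathrm{Spec}(R_{(g)})=\mathrm{Proj}_{B_R}(R)$$ from an open subscheme of $\mathrm{Proj}_{B_S}(S)$ which for each $g\in\mathrm{Rel}_{B_R}(R)$ restricts to the morphism $\mathrm{Spec}(S_{(f_g)})\to\mathrm{Spec}(R_{(g)})$ induced by $\varphi_g$. -/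

import Mathlib

open CategoryTheory CategoryTheory.Limits AlgebraicGeometry

universe u

set_option linter.unusedSectionVars false

namespace MultiProj

section Graded

variable {D S : Type u} [AddCommGroup D] [CommRing S]

/-- `x ∈ S_f` is homogeneous of degree `d`: `x = a / f ^ n` with `f`, `a` homogeneous and
`d = deg a - n • deg f`. -/
def IsHomogeneousFraction (𝒜 : D → AddSubgroup S) (f : S) (d : D) (x : Localization.Away f) :
    Prop :=
  ∃ (d₀ e : D) (n : ℕ) (a : S), f ∈ 𝒜 d₀ ∧ a ∈ 𝒜 e ∧
    x = Localization.mk a (⟨f ^ n, n, rfl⟩ : Submonoid.powers f) ∧ d = e - n • d₀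

/-- The group `D^f` generated by (in fact, consisting of) the degrees of the homogeneous units
of `S_f`. -/
def unitDegrees (𝒜 : D → AddSubgroup S) (f : S) : AddSubgroup D :=
  AddSubgroup.closure
    {d | ∃ x : (Localization.Away f)ˣ, IsHomogeneousFraction 𝒜 f d (x : Localization.Away f)}

/-- A homogeneous element `f` is relevant if `D^f` has finite index in `D`. -/
def IsRelevant (𝒜 : D → AddSubgroup S) (f : S) : Prop :=
  SetLike.IsHomogeneousElem 𝒜 f ∧ (unitDegrees 𝒜 f).FiniteIndex

/-- The irrelevant ideal `S_+`, generated by all relevant elements. -/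
def irrelevantIdeal (𝒜 : D → AddSubgroup S) : Ideal S :=
  Ideal.span {f | IsRelevant 𝒜 f}

/-- `x = f * g` for some homogeneous `g`. -/
def HomDvd (𝒜 : D → AddSubgroup S) (f x : S) : Prop :=
  ∃ g, SetLike.IsHomogeneousElem 𝒜 g ∧ x = f * g

variable [DecidableEq D] (𝒜 : D → AddSubgroup S) [GradedRing 𝒜]

/-- The canonical map `S_(f) → S_(x)` if `f` divides `x` with a homogeneous quotient. -/
noncomputable def awayDvd {f x : S} (h : HomDvd 𝒜 f x) :
    HomogeneousLocalization.Away 𝒜 f →+* HomogeneousLocalization.Away 𝒜 x :=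
  HomogeneousLocalization.awayMap 𝒜 h.choose_spec.1.choose_spec h.choose_spec.2

variable {𝒜}

theorem awayDvd_eq {f x g : S} {e : D} (h : HomDvd 𝒜 f x) (hg : g ∈ 𝒜 e) (hx : x = f * g) :
    awayDvd 𝒜 h = HomogeneousLocalization.awayMap 𝒜 hg hx := by
  ext a
  simp only [awayDvd, HomogeneousLocalization.val_awayMap]

theorem HomDvd.refl (f : S) : HomDvd 𝒜 f f :=
  ⟨1, ⟨0, SetLike.GradedOne.one_mem⟩, (mul_one f).symm⟩

theorem HomDvd.trans {f x y : S} (h : HomDvd 𝒜 f x) (h' : HomDvd 𝒜 x y) : HomDvd 𝒜 f y := by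
  obtain ⟨g, ⟨e, hg⟩, rfl⟩ := h
  obtain ⟨g', ⟨e', hg'⟩, rfl⟩ := h'
  exact ⟨g * g', ⟨e + e', SetLike.mul_mem_graded hg hg'⟩, mul_assoc _ _ _⟩

theorem HomDvd.mul_right (f : S) {g : S} (hg : SetLike.IsHomogeneousElem 𝒜 g) :
    HomDvd 𝒜 f (f * g) := ⟨g, hg, rfl⟩

theorem HomDvd.mul_left {f : S} (hf : SetLike.IsHomogeneousElem 𝒜 f) (g : S) :
    HomDvd 𝒜 g (f * g) := ⟨f, hf, mul_comm _ _⟩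

theorem awayDvd_awayDvd {f x y : S} (h : HomDvd 𝒜 f x) (h' : HomDvd 𝒜 x y) (h'' : HomDvd 𝒜 f y)
    (hf : SetLike.IsHomogeneousElem 𝒜 f) :
    (awayDvd 𝒜 h').comp (awayDvd 𝒜 h) = awayDvd 𝒜 h'' := by
  obtain ⟨d, hf⟩ := hf
  obtain ⟨g, ⟨e, hg⟩, rfl⟩ := id h
  obtain ⟨g', ⟨e', hg'⟩, rfl⟩ := id h'
  rw [awayDvd_eq h hg rfl, awayDvd_eq h' hg' rfl,
    awayDvd_eq h'' (SetLike.mul_mem_graded hg hg') (mul_assoc _ _ _)]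
  refine RingHom.ext fun a => ?_
  obtain ⟨n, s, hs, rfl⟩ := HomogeneousLocalization.Away.mk_surjective 𝒜 hf a
  simp only [RingHom.comp_apply, HomogeneousLocalization.awayMap_mk]
  ext
  simp only [HomogeneousLocalization.Away.val_mk, mul_pow, mul_assoc]

theorem awayDvd_refl {f : S} (h : HomDvd 𝒜 f f) (hf : SetLike.IsHomogeneousElem 𝒜 f) :
    awayDvd 𝒜 h = RingHom.id _ := by
  obtain ⟨d, hf⟩ := hf
  rw [awayDvd_eq h SetLike.GradedOne.one_mem (mul_one f).symm]
  refine RingHom.ext fun a => ?_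
  obtain ⟨n, s, hs, rfl⟩ := HomogeneousLocalization.Away.mk_surjective 𝒜 hf a
  rw [HomogeneousLocalization.awayMap_mk]
  ext
  simp

/-- Homogeneous units in degrees of `unitDegrees`, expressed through divisors of powers of `f`. -/
theorem exists_of_mem_unitDegrees {f : S} {d₀ d : D} (hf : f ∈ 𝒜 d₀)
    (hd : d ∈ unitDegrees 𝒜 f) :
    ∃ (l M : ℕ) (c c' : S), c ∈ 𝒜 (l • d₀ + d) ∧ c * c' = f ^ M := by
  induction hd using AddSubgroup.closure_induction with
  | mem d hd =>
    obtain ⟨x, d₁, e, n, a, hf₁, ha, hx, rfl⟩ := hd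
    by_cases h0 : f = 0
    · exact ⟨0, 1, 0, 0, zero_mem _, by simp [h0]⟩
    obtain rfl := DirectSum.degree_eq_of_mem_mem 𝒜 hf hf₁ h0
    obtain ⟨⟨b, ⟨_, m, rfl⟩⟩, hb⟩ := IsLocalization.mk'_surjective (Submonoid.powers f)
      ((x⁻¹ : (Localization.Away f)ˣ) : Localization.Away f)
    have h1 := x.mul_inv
    rw [hx, ← hb, ← Localization.mk_eq_mk', Localization.mk_mul, ← Localization.mk_one,
      Localization.mk_eq_mk_iff, Localization.r_iff_exists] at h1
    obtain ⟨⟨_, k, rfl⟩, h1⟩ := h1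
    refine ⟨n, k + n + m, a, f ^ k * b, by simpa using ha, ?_⟩
    simp only [OneMemClass.coe_one, one_mul, Submonoid.coe_mul, mul_one] at h1
    linear_combination h1
  | zero => exact ⟨0, 0, 1, 1, by simpa using SetLike.GradedOne.one_mem, by simp⟩
  | add x y _ _ hx hy =>
    obtain ⟨l, M, c, c', hc, h⟩ := hx
    obtain ⟨l', M', b, b', hb, h'⟩ := hy
    refine ⟨l + l', M + M', c * b, c' * b', ?_, by rw [pow_add, ← h, ← h']; ring⟩
    convert! SetLike.mul_mem_graded hc hb using 2
    rw [add_smul]; abel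
  | neg x _ hx =>
    obtain ⟨l, M, c, c', hc, h⟩ := hx
    refine ⟨M, M + l,
      (DirectSum.decompose 𝒜 c' (M • d₀ - (l • d₀ + x)) : S) * f ^ l, c, ?_, ?_⟩
    · convert! SetLike.mul_mem_graded (SetLike.coe_mem _) (SetLike.pow_mem_graded l hf) using 2
      abel
    · have h2 := DirectSum.coe_decompose_mul_add_of_left_mem 𝒜
        (i := l • d₀ + x) (j := M • d₀ - (l • d₀ + x)) (b := c') hc
      rw [h, add_sub_cancel, DirectSum.decompose_of_mem_same 𝒜 (SetLike.pow_mem_graded M hf)] at h2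
      rw [pow_add, h2]; ring

theorem exists_unit {f : S} {d e : D} (hf : f ∈ 𝒜 d) (hr : IsRelevant 𝒜 f) :
    ∃ (N l M : ℕ) (c c' : S), N ≠ 0 ∧ c ∈ 𝒜 (l • d - N • e) ∧
      c' ∈ 𝒜 (M • d - (l • d - N • e)) ∧ c * c' = f ^ M := by
  obtain ⟨N, hN, -, hNe⟩ :=
    AddSubgroup.exists_nsmul_mem_of_index_ne_zero hr.2.index_ne_zero e
  obtain ⟨l, M, c, c', hc, h⟩ := exists_of_mem_unitDegrees hf (neg_mem hNe)
  rw [← sub_eq_add_neg] at hc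
  refine ⟨N, l, M, c, _, hN.ne', hc,
    SetLike.coe_mem (DirectSum.decompose 𝒜 c' (M • d - (l • d - N • e))), ?_⟩
  rw [← DirectSum.coe_decompose_mul_add_of_left_mem 𝒜 hc, h, add_sub_cancel,
    DirectSum.decompose_of_mem_same 𝒜 (SetLike.pow_mem_graded M hf)]

theorem isLocalization_away {f g : S} {d e : D} (hf : f ∈ 𝒜 d) (hg : g ∈ 𝒜 e) {N l M : ℕ}
    {c c' : S} (hN : N ≠ 0) (hcd : c ∈ 𝒜 (l • d - N • e)) (hcd' : c' ∈ 𝒜 (M • d - (l • d - N • e)))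
    (hc : c * c' = f ^ M) (hw : g ^ N * c ∈ 𝒜 (l • d)) {x : S} (hx : x = f * g) :
    letI := (HomogeneousLocalization.awayMap 𝒜 hg hx).toAlgebra
    IsLocalization.Away (HomogeneousLocalization.Away.mk 𝒜 hf l (g ^ N * c) hw)
      (HomogeneousLocalization.Away 𝒜 x) := by
  let := (HomogeneousLocalization.awayMap 𝒜 hg hx).toAlgebra
  constructor; constructor
  · rintro ⟨r, n, rfl⟩
    rw [map_pow, RingHom.algebraMap_toAlgebra]
    let z : HomogeneousLocalization.Away 𝒜 x :=
      HomogeneousLocalization.Away.mk 𝒜 (hx ▸ SetLike.mul_mem_graded hf hg) (N + M)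
        (c' * (f ^ (l + N) * g ^ M)) <| by
      convert! SetLike.mul_mem_graded hcd' (SetLike.mul_mem_graded
        (SetLike.pow_mem_graded (l + N) hf) (SetLike.pow_mem_graded M hg)) using 2
      simp only [add_smul, smul_add]
      abel
    refine (isUnit_iff_exists_inv.mpr ⟨z, ?_⟩).pow _
    ext
    simp only [HomogeneousLocalization.val_mul, HomogeneousLocalization.val_one,
      HomogeneousLocalization.awayMap_mk, HomogeneousLocalization.Away.val_mk, z,
      Localization.mk_mul]
    rw [← Localization.mk_one, Localization.mk_eq_mk_iff, Localization.r_iff_exists]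
    use 1
    simp only [OneMemClass.coe_one, one_mul, Submonoid.coe_mul, mul_one, hx]
    linear_combination (g ^ N * g ^ l * f ^ (l + N) * g ^ M) * hc
  · intro z
    obtain ⟨n, s, hs, rfl⟩ := HomogeneousLocalization.Away.mk_surjective 𝒜
      (hx ▸ SetLike.mul_mem_graded hf hg) z
    obtain ⟨N, rfl⟩ := Nat.exists_eq_succ_of_ne_zero hN
    let t : HomogeneousLocalization.Away 𝒜 f :=
      HomogeneousLocalization.Away.mk 𝒜 hf (n * (l + 1)) (s * (g ^ (n * N) * c ^ n)) <| by
      convert! SetLike.mul_mem_graded hs (SetLike.mul_mem_graded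
        (SetLike.pow_mem_graded (n * N) hg) (SetLike.pow_mem_graded n hcd)) using 2
      simp only [add_smul, smul_add, mul_smul, smul_sub, Nat.succ_eq_add_one, mul_add, one_smul,
        mul_one]
      abel
    refine ⟨⟨t, ⟨_, ⟨n, rfl⟩⟩⟩, ?_⟩
    ext
    simp only [RingHom.algebraMap_toAlgebra, map_pow, HomogeneousLocalization.awayMap_mk,
      HomogeneousLocalization.val_mul, HomogeneousLocalization.Away.val_mk,
      HomogeneousLocalization.val_pow, Localization.mk_pow, Localization.mk_mul, t]
    rw [Localization.mk_eq_mk_iff, Localization.r_iff_exists]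
    exact ⟨1, by simp; ring⟩
  · intro a b e
    obtain ⟨n, a, ha, rfl⟩ := HomogeneousLocalization.Away.mk_surjective 𝒜 hf a
    obtain ⟨m, b, hb, rfl⟩ := HomogeneousLocalization.Away.mk_surjective 𝒜 hf b
    replace e := congr_arg HomogeneousLocalization.val e
    simp only [RingHom.algebraMap_toAlgebra, HomogeneousLocalization.awayMap_mk,
      HomogeneousLocalization.Away.val_mk,
      Localization.mk_eq_mk_iff, Localization.r_iff_exists] at e
    obtain ⟨⟨_, k, rfl⟩, hk⟩ := e
    refine ⟨⟨_, k + m + n, rfl⟩, ?_⟩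
    ext
    simp only [HomogeneousLocalization.val_mul, HomogeneousLocalization.val_pow,
      HomogeneousLocalization.Away.val_mk, Localization.mk_pow,
      Localization.mk_eq_mk_iff, Localization.r_iff_exists, Submonoid.coe_mul, Localization.mk_mul,
      SubmonoidClass.coe_pow, Subtype.exists, exists_prop]
    refine ⟨_, ⟨k, rfl⟩, ?_⟩
    obtain ⟨N, rfl⟩ := Nat.exists_eq_succ_of_ne_zero hN
    subst hx
    simp only [Nat.succ_eq_add_one] at hk ⊢
    linear_combination
      (c ^ (k + m + n) * g ^ (N * (k + m + n)) * f ^ (l * (k + m + n))) * hk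

/-- For relevant `f` and homogeneous `g` there is `w ∈ S_(f)` such that for each homogeneous
multiple `y` of `f`, the ring `S_(yg)` is the localization of `S_(y)` at the image of `w`. -/
theorem exists_forall_isLocalization {f g : S} (hr : IsRelevant 𝒜 f)
    (hg : SetLike.IsHomogeneousElem 𝒜 g) :
    ∃ w : HomogeneousLocalization.Away 𝒜 f, ∀ (y x : S) (hy : HomDvd 𝒜 f y) (h : HomDvd 𝒜 y x),
      x = y * g → letI := (awayDvd 𝒜 h).toAlgebra
        IsLocalization.Away (awayDvd 𝒜 hy w) (HomogeneousLocalization.Away 𝒜 x) := by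
  obtain ⟨d, hf⟩ := id hr.1
  obtain ⟨e, hg⟩ := hg
  obtain ⟨N, l, M, c, c', hN, hcd, hcd', hc⟩ := exists_unit (e := e) hf hr
  have hw : g ^ N * c ∈ 𝒜 (l • d) := by
    convert! SetLike.mul_mem_graded (SetLike.pow_mem_graded N hg) hcd using 2
    abel
  refine ⟨HomogeneousLocalization.Away.mk 𝒜 hf l (g ^ N * c) hw, fun y x hy h hx => ?_⟩
  obtain ⟨k, ⟨d', hk⟩, rfl⟩ := id hy
  have h1 : c * k ^ l ∈ 𝒜 (l • (d + d') - N • e) := by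
    convert! SetLike.mul_mem_graded hcd (SetLike.pow_mem_graded l hk) using 2
    rw [smul_add]; abel
  have h2 : c' * (f ^ l * k ^ M) ∈ 𝒜 ((M + l) • (d + d') - (l • (d + d') - N • e)) := by
    convert! SetLike.mul_mem_graded hcd' (SetLike.mul_mem_graded (SetLike.pow_mem_graded l hf)
      (SetLike.pow_mem_graded M hk)) using 2
    simp only [smul_add, add_smul]; abel
  have hw' : g ^ N * (c * k ^ l) ∈ 𝒜 (l • (d + d')) := by
    convert! SetLike.mul_mem_graded (SetLike.pow_mem_graded N hg) h1 using 2
    abel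
  have := isLocalization_away (SetLike.mul_mem_graded hf hk) hg hN h1 h2
    (by linear_combination (f ^ l * k ^ (M + l)) * hc) hw' hx
  rw [awayDvd_eq h hg hx, awayDvd_eq hy hk rfl, HomogeneousLocalization.awayMap_mk]
  have hw2 : HomogeneousLocalization.Away.mk 𝒜 (SetLike.mul_mem_graded hf hk) l
      (g ^ N * c * k ^ l) (by rw [mul_assoc]; exact hw') =
      HomogeneousLocalization.Away.mk 𝒜 (SetLike.mul_mem_graded hf hk) l _ hw' := by
    ext
    simp [mul_assoc]
  rw [hw2]
  exact this

end Graded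

section Glue

variable {D S : Type u} [AddCommGroup D] [DecidableEq D] [CommRing S]
  (𝒜 : D → AddSubgroup S) [GradedRing 𝒜]

/-- The affine scheme `Spec S_(f)`. -/
noncomputable abbrev specAway (f : S) : Scheme.{u} :=
  Spec (CommRingCat.of (HomogeneousLocalization.Away 𝒜 f))

/-- The canonical morphism `Spec S_(x) → Spec S_(f)` if `f` divides `x` with a homogeneous
quotient. -/
noncomputable def specDvd {f x : S} (h : HomDvd 𝒜 f x) : specAway 𝒜 x ⟶ specAway 𝒜 f :=
  Spec.map (CommRingCat.ofHom (awayDvd 𝒜 h))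

variable {𝒜}

theorem specDvd_specDvd {f x y : S} (h : HomDvd 𝒜 f x) (h' : HomDvd 𝒜 x y)
    (hf : SetLike.IsHomogeneousElem 𝒜 f) :
    specDvd 𝒜 h' ≫ specDvd 𝒜 h = specDvd 𝒜 (h.trans h') := by
  rw [specDvd, specDvd, specDvd, ← Spec.map_comp, ← CommRingCat.ofHom_comp,
    awayDvd_awayDvd h h' (h.trans h') hf]

theorem specDvd_refl {f : S} (h : HomDvd 𝒜 f f) (hf : SetLike.IsHomogeneousElem 𝒜 f) :
    specDvd 𝒜 h = 𝟙 _ := by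
  rw [specDvd, awayDvd_refl h hf]
  exact Spec.map_id _

theorem isOpenImmersion_specDvd {f y x g : S} (hr : IsRelevant 𝒜 f)
    (hg : SetLike.IsHomogeneousElem 𝒜 g) (hy : HomDvd 𝒜 f y) (h : HomDvd 𝒜 y x)
    (hx : x = y * g) : IsOpenImmersion (specDvd 𝒜 h) := by
  obtain ⟨w, hw⟩ := exists_forall_isLocalization hr hg
  have := hw y x hy h hx
  let := (awayDvd 𝒜 h).toAlgebra
  exact IsOpenImmersion.of_isLocalization (R := HomogeneousLocalization.Away 𝒜 y)
    (S := HomogeneousLocalization.Away 𝒜 x) (awayDvd 𝒜 hy w)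

theorem range_specDvd {f y x z g : S} (hr : IsRelevant 𝒜 f)
    (hg : SetLike.IsHomogeneousElem 𝒜 g) (hy : HomDvd 𝒜 f y) (h : HomDvd 𝒜 y x)
    (hx : x = y * g) (h' : HomDvd 𝒜 f z) (hz : z = f * g) :
    Set.range (specDvd 𝒜 h) = (specDvd 𝒜 hy) ⁻¹' Set.range (specDvd 𝒜 h') := by
  obtain ⟨w, hw⟩ := exists_forall_isLocalization hr hg
  have h1 : Set.range (specDvd 𝒜 h) =
      {p | awayDvd 𝒜 hy w ∉ p.asIdeal} := by
    have := hw y x hy h hx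
    let := (awayDvd 𝒜 h).toAlgebra
    exact PrimeSpectrum.localization_away_comap_range (HomogeneousLocalization.Away 𝒜 x)
      (awayDvd 𝒜 hy w)
  have h2 : Set.range (specDvd 𝒜 h') = {p | w ∉ p.asIdeal} := by
    have := hw f z (.refl f) h' hz
    rw [awayDvd_refl _ hr.1, RingHom.id_apply] at this
    let := (awayDvd 𝒜 h').toAlgebra
    exact PrimeSpectrum.localization_away_comap_range (HomogeneousLocalization.Away 𝒜 z) w
  rw [h1, h2]
  rfl

variable (𝒜)

/-- The relevant elements of `S`. -/
abbrev Rel : Type u := {f : S // IsRelevant 𝒜 f}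

variable {𝒜}

theorem Rel.hom (f : Rel 𝒜) : SetLike.IsHomogeneousElem 𝒜 (f : S) := f.2.1

theorem homogeneous_mul {f g : S} (hf : SetLike.IsHomogeneousElem 𝒜 f)
    (hg : SetLike.IsHomogeneousElem 𝒜 g) : SetLike.IsHomogeneousElem 𝒜 (f * g) :=
  hf.mul hg

theorem dvdL (f g : Rel 𝒜) : HomDvd 𝒜 (f : S) (f * g) := ⟨g, g.hom, rfl⟩

theorem dvdSwap (f g : S) : HomDvd 𝒜 (g * f) (f * g) :=
  ⟨1, ⟨0, SetLike.GradedOne.one_mem⟩, by ring⟩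

instance (f g : Rel 𝒜) : IsOpenImmersion (specDvd 𝒜 (dvdL f g)) :=
  isOpenImmersion_specDvd f.2 g.hom (.refl _) _ rfl

theorem dvd3L (f g h : Rel 𝒜) : HomDvd 𝒜 (f * g : S) (f * g * h) := ⟨h, h.hom, rfl⟩

theorem dvd3R (f g h : Rel 𝒜) : HomDvd 𝒜 (f * h : S) (f * g * h) := ⟨g, g.hom, by ring⟩

theorem dvd3Rot (f g h : Rel 𝒜) : HomDvd 𝒜 (g * h * f : S) (f * g * h) :=
  ⟨1, ⟨0, SetLike.GradedOne.one_mem⟩, by ring⟩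

/-- The comparison map `Spec S_(fgh) → Spec S_(fg) ×_{Spec S_(f)} Spec S_(fh)`. -/
noncomputable def toTriple (f g h : Rel 𝒜) : specAway 𝒜 (f * g * h : S) ⟶
    pullback (specDvd 𝒜 (dvdL f g)) (specDvd 𝒜 (dvdL f h)) :=
  pullback.lift (specDvd 𝒜 (dvd3L f g h)) (specDvd 𝒜 (dvd3R f g h)) (by
    rw [specDvd_specDvd _ _ f.hom, specDvd_specDvd _ _ f.hom])

instance (f g h : Rel 𝒜) : IsIso (toTriple f g h) := by
  have h1 : IsOpenImmersion (specDvd 𝒜 (dvd3L f g h)) :=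
    isOpenImmersion_specDvd f.2 h.hom (dvdL f g) _ rfl
  have h2 : IsOpenImmersion (toTriple f g h) := by
    have : IsOpenImmersion (toTriple f g h ≫ pullback.fst _ _) := by
      rw [toTriple, pullback.lift_fst]; exact h1
    exact IsOpenImmersion.of_comp (toTriple f g h) (pullback.fst _ _)
  have h3 : Function.Surjective (toTriple f g h) := by
    intro p
    have hp : pullback.fst (specDvd 𝒜 (dvdL f g)) (specDvd 𝒜 (dvdL f h)) p ∈
        Set.range (specDvd 𝒜 (dvd3L f g h)) := by
      rw [range_specDvd f.2 h.hom (dvdL f g) (dvd3L f g h) rfl (dvdL f h) rfl]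
      refine ⟨pullback.snd (specDvd 𝒜 (dvdL f g)) (specDvd 𝒜 (dvdL f h)) p, ?_⟩
      rw [← Scheme.Hom.comp_apply, ← Scheme.Hom.comp_apply, pullback.condition]
    obtain ⟨q, hq⟩ := hp
    refine ⟨q, (pullback.fst (specDvd 𝒜 (dvdL f g)) (specDvd 𝒜 (dvdL f h))).isOpenEmbedding.injective ?_⟩
    rw [← hq, ← Scheme.Hom.comp_apply, toTriple, pullback.lift_fst]
  have : Surjective (toTriple f g h) := ⟨h3⟩
  exact (isIso_iff_isOpenImmersion_and_surjective _).mpr ⟨h2, this⟩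

theorem isIso_specDvd_self (f : Rel 𝒜) : IsIso (specDvd 𝒜 (dvdL f f)) := by
  obtain ⟨d, hf⟩ := f.hom
  have h1 : (1 : S) ∈ 𝒜 (1 • d - 1 • d) := by rw [sub_self]; exact SetLike.GradedOne.one_mem
  have h1' : (1 : S) ∈ 𝒜 (0 • d - (1 • d - 1 • d)) := by
    rw [sub_self, zero_smul, sub_self]; exact SetLike.GradedOne.one_mem
  have hw : (f : S) ^ 1 * 1 ∈ 𝒜 (1 • d) := by simpa using hf
  have := isLocalization_away (x := (f : S) * f) (M := 0) hf hf one_ne_zero h1 h1' (by simp) hw rfl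
  have hw1 : IsUnit (HomogeneousLocalization.Away.mk 𝒜 hf 1 ((f : S) ^ 1 * 1) hw) := by
    convert! isUnit_one
    ext
    simp only [HomogeneousLocalization.Away.val_mk, HomogeneousLocalization.val_one, mul_one]
    exact Localization.mk_self (⟨(f : S) ^ 1, 1, rfl⟩ : Submonoid.powers (f : S))
  let := (HomogeneousLocalization.awayMap 𝒜 hf (rfl : (f : S) * f = f * f)).toAlgebra
  have hb := (IsLocalization.atUnit (HomogeneousLocalization.Away 𝒜 (f : S))
    (HomogeneousLocalization.Away 𝒜 ((f : S) * f)) _ hw1).bijective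
  have : IsIso (CommRingCat.ofHom (awayDvd 𝒜 (dvdL f f))) := by
    rw [ConcreteCategory.isIso_iff_bijective, awayDvd_eq _ hf rfl]
    convert! hb using 1
  rw [specDvd]
  infer_instance

/-- The gluing datum of the affine schemes `Spec S_(f)`, `f` relevant, along `Spec S_(fg)`. -/
noncomputable def projGlueData (𝒜 : D → AddSubgroup S) [GradedRing 𝒜] : Scheme.GlueData.{u} where
  J := Rel 𝒜
  U f := specAway 𝒜 (f : S)
  V p := specAway 𝒜 (p.1 * p.2 : S)
  f f g := specDvd 𝒜 (dvdL f g)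
  f_hasPullback _ _ _ := inferInstance
  f_id f := isIso_specDvd_self f
  t f g := specDvd 𝒜 (dvdSwap (f : S) g)
  t_id f := specDvd_refl _ (f.hom.mul f.hom)
  t' f g h := inv (toTriple f g h) ≫ specDvd 𝒜 (dvd3Rot f g h) ≫ toTriple g h f
  t_fac f g h := by
    rw [Category.assoc, Category.assoc, IsIso.inv_comp_eq, toTriple, toTriple, pullback.lift_snd,
      pullback.lift_fst_assoc, specDvd_specDvd _ _ (g.hom.mul f.hom),
      specDvd_specDvd _ _ (g.hom.mul f.hom)]
  cocycle f g h := by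
    have h1 := (f.hom.mul g.hom).mul h.hom
    have h2 : specDvd 𝒜 (dvd3Rot f g h) ≫ specDvd 𝒜 (dvd3Rot g h f) ≫ specDvd 𝒜 (dvd3Rot h f g) =
        𝟙 _ := by
      rw [specDvd_specDvd _ _ h1,
        specDvd_specDvd _ _ h1, specDvd_refl _ h1]
    simp only [Category.assoc, IsIso.hom_inv_id_assoc]
    rw [IsIso.inv_comp_eq, Category.comp_id]
    simpa only [Category.assoc, Category.id_comp] using congrArg (· ≫ toTriple f g h) h2
  f_open _ _ := inferInstance

/-- The scheme `Proj^D(S)`, the union of all `Spec S_(f)` for relevant `f`. -/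
noncomputable def projScheme (𝒜 : D → AddSubgroup S) [GradedRing 𝒜] : Scheme.{u} :=
  (projGlueData 𝒜).glued

/-- The inclusion of the affine open subscheme `Spec S_(f)` into `Proj^D(S)`. -/
noncomputable def projι (f : Rel 𝒜) : specAway 𝒜 (f : S) ⟶ projScheme 𝒜 :=
  (projGlueData 𝒜).ι f

instance (f : Rel 𝒜) : IsOpenImmersion (projι f) :=
  Scheme.GlueData.ι_isOpenImmersion (projGlueData 𝒜) f

variable (𝒜)

/-- The open subset `⋃_{f ∈ A relevant} Spec S_(f)` of `Proj^D(S)`. -/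
noncomputable def projOpen (A : Set S) : (projScheme 𝒜).Opens :=
  ⨆ f : Rel 𝒜, ⨆ _ : (f : S) ∈ A, (projι f).opensRange

/-- The inclusion of `Spec S_(f)` into the open subscheme `⋃_{f ∈ A relevant} Spec S_(f)`. -/
noncomputable def chart (A : Set S) (f : S) (hr : IsRelevant 𝒜 f) (hA : f ∈ A) :
    specAway 𝒜 f ⟶ (projOpen 𝒜 A).toScheme :=
  IsOpenImmersion.lift (projOpen 𝒜 A).ι (projι (⟨f, hr⟩ : Rel 𝒜)) (by
    rw [Scheme.Opens.range_ι]
    exact le_iSup₂ (f := fun (f : Rel 𝒜) (_ : (f : S) ∈ A) => (projι f).opensRange) ⟨f, hr⟩ hA)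

end Glue

section Factorial

variable {D S : Type u} [CommRing S] (𝒜 : D → AddSubgroup S)

/-- A `D`-prime element: a homogeneous nonzero nonunit `p` such that `p ∣ a * b` implies `p ∣ a`
or `p ∣ b` for all homogeneous `a`, `b`. -/
def IsGradedPrime (p : S) : Prop :=
  SetLike.IsHomogeneousElem 𝒜 p ∧ p ≠ 0 ∧ ¬ IsUnit p ∧
    ∀ a b, SetLike.IsHomogeneousElem 𝒜 a → SetLike.IsHomogeneousElem 𝒜 b →
      p ∣ a * b → p ∣ a ∨ p ∣ b

/-- Factorially graded rings: there are no homogeneous zero divisors, and every homogeneous nonzero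
nonunit is a product of `D`-prime elements. -/
def IsFactoriallyGraded : Prop :=
  (∀ a b, SetLike.IsHomogeneousElem 𝒜 a → SetLike.IsHomogeneousElem 𝒜 b →
    a * b = 0 → a = 0 ∨ b = 0) ∧
  ∀ a, SetLike.IsHomogeneousElem 𝒜 a → a ≠ 0 → ¬ IsUnit a →
    ∃ s : Multiset S, (∀ p ∈ s, IsGradedPrime 𝒜 p) ∧ s.prod = a

end Factorial

/-- A multigraded ring: a commutative ring graded by a finitely generated abelian group that is
generated by the degrees which occur. -/
structure MultigradedRing : Type (u + 1) where
  Deg : Type u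
  Carrier : Type u
  [addCommGroup : AddCommGroup Deg]
  [decEq : DecidableEq Deg]
  [commRing : CommRing Carrier]
  piece : Deg → AddSubgroup Carrier
  [graded : GradedRing piece]
  fg : AddGroup.FG Deg
  effective : AddSubgroup.closure {d | piece d ≠ ⊥} = ⊤

attribute [instance] MultigradedRing.addCommGroup MultigradedRing.decEq MultigradedRing.commRing
  MultigradedRing.graded

/-- A morphism `(φ, α)` of multigraded rings. -/
structure MultigradedHom (R S : MultigradedRing.{u}) where
  toRingHom : R.Carrier →+* S.Carrier
  degHom : R.Deg →+ S.Deg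
  map_mem : ∀ d, ∀ a ∈ R.piece d, toRingHom a ∈ S.piece (degHom d)

namespace MultigradedHom

variable {R S : MultigradedRing.{u}}

/-- The ring homomorphism `R_(g) → S_(φ(g))`, `a / g ^ n ↦ φ(a) / φ(g) ^ n`. -/
def away (φ : MultigradedHom R S) (g : R.Carrier) :
    HomogeneousLocalization.Away R.piece g →+*
      HomogeneousLocalization.Away S.piece (φ.toRingHom g) where
  toFun := Quotient.map'
    (fun x => ⟨φ.degHom x.deg, ⟨φ.toRingHom x.num, φ.map_mem _ _ x.num.2⟩,
      ⟨φ.toRingHom x.den, φ.map_mem _ _ x.den.2⟩, by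
        obtain ⟨n, hn⟩ := x.den_mem
        exact ⟨n, by simp only at hn ⊢; rw [← hn, map_pow]⟩⟩)
    fun x y (e : x.embedding = y.embedding) => by
      simp only [HomogeneousLocalization.NumDenSameDeg.embedding, Localization.mk_eq_mk_iff,
        Localization.r_iff_exists] at e
      obtain ⟨⟨_, k, rfl⟩, hk⟩ := e
      change Localization.mk _ _ = Localization.mk _ _
      rw [Localization.mk_eq_mk_iff, Localization.r_iff_exists]
      refine ⟨⟨_, k, rfl⟩, ?_⟩
      simpa using congrArg φ.toRingHom hk
  map_add' := Quotient.ind₂' fun x y => by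
    ext
    simp [← HomogeneousLocalization.mk_add]
  map_mul' := Quotient.ind₂' fun x y => by
    ext
    simp [← HomogeneousLocalization.mk_mul]
  map_zero' := by
    ext
    simp [← HomogeneousLocalization.mk_zero]
  map_one' := by
    ext
    simp [← HomogeneousLocalization.mk_one]

/-- The grading of the subring `φ(R) ⊆ S` by the grading group of `S`, with pieces `φ(R) ∩ S_d`. -/
def imagePiece (φ : MultigradedHom R S) (d : S.Deg) : AddSubgroup φ.toRingHom.range :=
  (S.piece d).comap φ.toRingHom.range.subtype.toAddMonoidHom

/-- The rational locus of `φ`: the relevant elements `g` of `R` such that `φ(g)` is relevant in the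
`D_S`-graded ring `φ(R)`. -/
def ratLocus (φ : MultigradedHom R S) : Set R.Carrier :=
  {g | IsRelevant R.piece g ∧ IsRelevant φ.imagePiece (φ.toRingHom.rangeRestrict g)}

end MultigradedHom

/-- A conical ring `(S, B)`: a multigraded ring with a homogeneous ideal `B ⊆ S_+`. -/
structure ConicalRing : Type (u + 1) extends MultigradedRing.{u} where
  B : Ideal Carrier
  homogeneous_B : B.IsHomogeneous piece
  B_le : B ≤ irrelevantIdeal piece

namespace ConicalRing

/-- The set of `B`-relevant elements. -/
def relB (X : ConicalRing.{u}) : Set X.Carrier :=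
  {f | IsRelevant X.piece f ∧ f ∈ X.B}

/-- The `B_S`-relevant locus of `φ : R → S`. -/
def relLocus {X Y : ConicalRing.{u}} (φ : MultigradedHom X.toMultigradedRing Y.toMultigradedRing) :
    Set Y.Carrier :=
  {f ∈ Y.relB | ∃ g ∈ X.relB, φ.toRingHom g = f}

/-- A morphism `(R, B_R) → (S, B_S)` of conical rings: a morphism of multigraded rings such that
every `B_S`-relevant element is the image of a `B_R`-relevant element. -/
@[ext]
structure Hom (X Y : ConicalRing.{u}) extends
    MultigradedHom X.toMultigradedRing Y.toMultigradedRing where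
  relevant : Y.relB = relLocus toMultigradedHom

instance : Category ConicalRing.{u} where
  Hom := Hom
  id X :=
    { toRingHom := RingHom.id _
      degHom := AddMonoidHom.id _
      map_mem := fun _ _ h => h
      relevant := Set.ext fun f => ⟨fun hf => ⟨hf, f, hf, rfl⟩, fun hf => hf.1⟩ }
  comp {X Y Z} φ ψ :=
    { toRingHom := ψ.toRingHom.comp φ.toRingHom
      degHom := ψ.degHom.comp φ.degHom
      map_mem := fun d a ha => ψ.map_mem _ _ (φ.map_mem d a ha)
      relevant := Set.ext fun f => ⟨fun hf => by
          obtain ⟨-, g, hg, rfl⟩ := ψ.relevant ▸ hf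
          obtain ⟨-, k, hk, rfl⟩ := φ.relevant ▸ hg
          exact ⟨hf, k, hk, rfl⟩, fun hf => hf.1⟩ }

/-- The scheme `Proj^D_B(S) = ⋃_{f ∈ Rel_B} Spec S_(f)`, an open subscheme of `Proj^D(S)`. -/
noncomputable def Proj (X : ConicalRing.{u}) : Scheme.{u} :=
  (projOpen X.piece X.relB).toScheme

/-- The inclusion of the affine open subscheme `Spec S_(f)` into `Proj^D_B(S)`. -/
noncomputable def projChart (X : ConicalRing.{u}) (f : X.Carrier) (hf : f ∈ X.relB) :
    specAway X.piece f ⟶ X.Proj :=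
  chart X.piece X.relB f hf.1 hf

/-- `φ` is a rationally relevant morphism on `(R, B_R)`: each `B_R`-relevant element of `R` lies in
the rational locus. -/
def IsRationallyRelevant (X : ConicalRing.{u}) {S : MultigradedRing.{u}}
    (φ : MultigradedHom X.toMultigradedRing S) : Prop :=
  X.relB ⊆ φ.ratLocus

/-- A minimal generating system of the set of `B`-relevant elements: a set of `B`-relevant elements
that generates the same ideal as all `B`-relevant elements and has no proper subset with this
property. -/
def IsMinimalGeneratingSystem (X : ConicalRing.{u}) (G : Set X.Carrier) : Prop :=
  G ⊆ X.relB ∧ Ideal.span G = Ideal.span X.relB ∧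
    ∀ G' ⊆ G, Ideal.span G' = Ideal.span X.relB → G' = G

end ConicalRing

theorem HomDvd.of_dvd {D S : Type u} [AddCommGroup D] [DecidableEq D] [CommRing S]
    {𝒜 : D → AddSubgroup S} [GradedRing 𝒜] {a f : S} (ha : SetLike.IsHomogeneousElem 𝒜 a)
    (hf : SetLike.IsHomogeneousElem 𝒜 f) (h : a ∣ f) : HomDvd 𝒜 a f := by
  obtain ⟨i, ha⟩ := ha
  obtain ⟨j, hf⟩ := hf
  obtain ⟨c, rfl⟩ := h
  refine ⟨_, ⟨j - i, SetLike.coe_mem (DirectSum.decompose 𝒜 c (j - i))⟩, ?_⟩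
  rw [← DirectSum.coe_decompose_mul_add_of_left_mem 𝒜 ha, add_sub_cancel,
    DirectSum.decompose_of_mem_same 𝒜 hf]

/-- A rational map `(R, B_R) ⇢ (S, B_S)` of conical rings: a map `φ : B_R → h(S)` together with, for
each relevant `g ∈ B_R`, a relevant `f_g ∈ B_S` such that `φ(g) ∣ f_g` and `S_(φ(g)) = S_(f_g)`
(that is, the canonical map is bijective), and ring homomorphisms `φ_g : R_(g) → S_(f_g)` which are
compatible on overlaps: `φ_g` and `φ_{g'}` have a common extension `R_(gg') → S_(f_g f_{g'})`. -/
structure RationalMap (X Y : ConicalRing.{u}) where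
  toFun : X.B → Y.Carrier
  homogeneous : ∀ b, SetLike.IsHomogeneousElem Y.piece (toFun b)
  target : X.relB → Y.Carrier
  target_mem : ∀ g, target g ∈ Y.relB
  dvd : ∀ g : X.relB, toFun ⟨g, g.2.2⟩ ∣ target g
  bijective : ∀ g : X.relB, Function.Bijective
    (awayDvd Y.piece (HomDvd.of_dvd (homogeneous _) (target_mem g).1.1 (dvd g)))
  localMap : ∀ g : X.relB, HomogeneousLocalization.Away X.piece (g : X.Carrier) →+*
    HomogeneousLocalization.Away Y.piece (target g)
  compatible : ∀ g g' : X.relB,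
    ∃ ψ : HomogeneousLocalization.Away X.piece ((g : X.Carrier) * g') →+*
        HomogeneousLocalization.Away Y.piece (target g * target g'),
      ψ.comp (awayDvd X.piece (.mul_right (g : X.Carrier) g'.2.1.1)) =
          (awayDvd Y.piece (.mul_right (target g) (target_mem g').1.1)).comp (localMap g) ∧
        ψ.comp (awayDvd X.piece (.mul_left g.2.1.1 (g' : X.Carrier))) =
          (awayDvd Y.piece (.mul_left (target_mem g).1.1 (target g'))).comp (localMap g')

end MultiProj

open MultiProj

namespace MultiProj

/-! ### Relevance, overlaps and covers inside Proj. -/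

section Graded

variable {D R S : Type u} [AddCommGroup D] [DecidableEq D] [CommRing R] [CommRing S]
  {𝒜 : D → AddSubgroup R} {ℬ : D → AddSubgroup S} [GradedRing ℬ]

/-! All the morphisms come from one gluing argument. The charts `Spec S_(f)` and `Spec S_(g)` meet
in `Spec S_(fg)`, so a family of maps `θ_i : R_(s_i) → S_(t_i)` defines a unique morphism into
`Proj_B(R)` as soon as the charts of the `t_i` cover the source and `θ_i`, `θ_j` have a common
extension `R_(s_i s_j) → S_(t_i t_j)` (`existsUnique_glue_localMap`). For a graded map `φ` this
extension is `φ` localized at the product; for a rational map it is part of the data. Functoriality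
then follows from uniqueness, checked on charts.

What remains is to decide when charts cover. If `f ^ n` lies in the ideal generated by a set `G` of
relevant elements, then `Spec S_(f)` is covered by the `Spec S_(g)`, `g ∈ G`
(`opensRange_projι_le`): otherwise some prime of `S_(f)` would contain `f ^ n / f ^ n = 1`. This
covers a change of generating system. It also covers the case where `B_S` is generated by `φ(B_R)`,
because `B_R` lies in the radical of the ideal generated by its relevant elements (`B_le_radical`).

Relevance is controlled by one principle: a graded map of localizations sends homogeneous units to
homogeneous units of the same degree, so the group of unit degrees can only grow. -/

theorem unitDegrees_le_of_mul (ψ : R →+* S) (hψ : ∀ d, ∀ a ∈ 𝒜 d, ψ a ∈ ℬ d) (f : R) {g : S}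
    (hg : SetLike.IsHomogeneousElem ℬ g) : unitDegrees 𝒜 f ≤ unitDegrees ℬ (ψ f * g) := by
  refine AddSubgroup.closure_mono ?_
  rintro d ⟨x, d₀, e, n, a, hf, ha, hx, rfl⟩
  obtain ⟨k, hg⟩ := hg
  let ι := algebraMap S (Localization.Away (ψ f * g))
  have hu : IsUnit (ι (ψ f * g)) := IsLocalization.Away.algebraMap_isUnit _
  have hu' : IsUnit ((ι.comp ψ) f) := by
    rw [map_mul] at hu
    exact isUnit_of_mul_isUnit_left hu
  let θ : Localization.Away f →+* Localization.Away (ψ f * g) := IsLocalization.Away.lift f hu'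
  -- The image of `a / f ^ n` is `ψ a / ψ f ^ n`. Expanding by `g ^ n` makes the denominator a power
  -- of `ψ f * g` and adds `n • k` to both degrees, so the degree of the fraction is unchanged.
  refine ⟨Units.map θ x, d₀ + k, e + n • k, n, ψ a * g ^ n,
    SetLike.mul_mem_graded (hψ _ _ hf) hg,
    SetLike.mul_mem_graded (hψ _ _ ha) (SetLike.pow_mem_graded n hg), ?_, ?_⟩
  · have h1 : (x : Localization.Away f) * algebraMap R _ (f ^ n) = algebraMap R _ a := by
      rw [hx, Localization.mk_eq_mk']
      exact IsLocalization.mk'_spec _ a (⟨f ^ n, n, rfl⟩ : Submonoid.powers f)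
    have h2 := congrArg θ h1
    simp only [map_mul, θ, IsLocalization.Away.lift_eq, RingHom.comp_apply] at h2
    rw [Localization.mk_eq_mk', IsLocalization.eq_mk'_iff_mul_eq]
    simp only [map_mul, map_pow] at h2 ⊢
    change θ x * (ι (ψ f) * ι g) ^ n = ι (ψ a) * ι g ^ n
    change θ x * (ι (ψ f)) ^ n = ι (ψ a) at h2
    rw [← h2]
    ring
  · rw [smul_add]; abel

theorem IsRelevant.map (ψ : R →+* S) (hψ : ∀ d, ∀ a ∈ 𝒜 d, ψ a ∈ ℬ d) {f : R}
    (hf : IsRelevant 𝒜 f) : IsRelevant ℬ (ψ f) := by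
  obtain ⟨⟨d, hd⟩, hi⟩ := hf
  refine ⟨⟨d, hψ d f hd⟩, ?_⟩
  have := unitDegrees_le_of_mul (𝒜 := 𝒜) ψ hψ f (SetLike.isHomogeneousElem_one ℬ)
  rw [mul_one] at this
  exact AddSubgroup.finiteIndex_of_le this

theorem IsRelevant.mul_right {f g : S} (hf : IsRelevant ℬ f)
    (hg : SetLike.IsHomogeneousElem ℬ g) : IsRelevant ℬ (f * g) := by
  obtain ⟨h, hi⟩ := hf
  exact ⟨h.mul hg, AddSubgroup.finiteIndex_of_le
    (unitDegrees_le_of_mul (𝒜 := ℬ) (.id S) (fun _ _ h => h) f hg)⟩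

/-- The inverse of a homogeneous unit may be taken homogeneous, so `1` is a homogeneous multiple of
`f`. This makes `{1}` an admissible generating system when a relevant element is a unit. -/
theorem IsRelevant.one_of_isUnit {f : S} (hf : IsRelevant ℬ f) (hu : IsUnit f) :
    IsRelevant ℬ (1 : S) := by
  obtain ⟨g, hg⟩ := isUnit_iff_exists_inv.mp hu
  obtain ⟨k, hk, h⟩ := HomDvd.of_dvd hf.1 (SetLike.isHomogeneousElem_one ℬ) ⟨g, hg.symm⟩
  rw [h]
  exact hf.mul_right hk

/-- If `k` has the same degree as `f ^ n`, then the image of `Spec S_(fk)` in `Spec S_(f)` is the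
locus where `k / f ^ n` does not vanish. -/
theorem range_specDvd_mul {f k : S} {d : D} (hf : f ∈ ℬ d) {n : ℕ} (hk : k ∈ ℬ (n • d))
    (h : HomDvd ℬ f (f * k)) : Set.range (specDvd ℬ h) =
      {p | HomogeneousLocalization.Away.mk ℬ hf n k hk ∉ p.asIdeal} := by
  have h1 : (1 : S) ∈ ℬ (n • d - 1 • n • d) := by
    rw [one_smul, sub_self]; exact SetLike.GradedOne.one_mem
  have h2 : (1 : S) ∈ ℬ (0 • d - (n • d - 1 • n • d)) := by
    rw [one_smul, sub_self, zero_smul, sub_self]; exact SetLike.GradedOne.one_mem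
  have hw : k ^ 1 * 1 ∈ ℬ (n • d) := by simpa using hk
  -- Since `k` already has the degree of `f ^ n`, no unit is needed to correct its degree: `N = 1`,
  -- `l = n` and `c = c' = 1`.
  have := isLocalization_away (M := 0) hf hk one_ne_zero h1 h2 (by simp) hw rfl
  have hw' : HomogeneousLocalization.Away.mk ℬ hf n (k ^ 1 * 1) hw =
      HomogeneousLocalization.Away.mk ℬ hf n k hk := by
    ext
    simp
  rw [hw'] at this
  let := (HomogeneousLocalization.awayMap ℬ hk (rfl : f * k = f * k)).toAlgebra
  rw [specDvd, awayDvd_eq h hk rfl]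
  exact PrimeSpectrum.localization_away_comap_range (HomogeneousLocalization.Away ℬ (f * k))
      (HomogeneousLocalization.Away.mk ℬ hf n k hk)

/-- The gluing condition in `Proj`. -/
theorem specDvd_projι (f g : Rel ℬ) (h : HomDvd ℬ (f : S) (f * g))
    (h' : HomDvd ℬ (g : S) (f * g)) : specDvd ℬ h ≫ projι f = specDvd ℬ h' ≫ projι g := by
  have h1 := (projGlueData ℬ).glue_condition f g
  have h2 : specDvd ℬ (dvdSwap (f : S) g) ≫ specDvd ℬ (dvdL g f) = specDvd ℬ h' :=
    specDvd_specDvd _ _ g.hom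
  rw [← h2, Category.assoc]
  exact h1.symm

/-- In a gluing datum the overlap is the fibre product of the two charts; it only remains to absorb
the transition map between `f * g` and `g * f`. -/
theorem isPullback_projι (f g : Rel ℬ) (h : HomDvd ℬ (f : S) (f * g))
    (h' : HomDvd ℬ (g : S) (f * g)) :
    IsPullback (specDvd ℬ h) (specDvd ℬ h') (projι f) (projι g) := by
  have h2 : specDvd ℬ (dvdSwap (f : S) g) ≫ specDvd ℬ (dvdL g f) = specDvd ℬ h' :=
    specDvd_specDvd _ _ g.hom
  rw [← h2]
  exact ⟨⟨((projGlueData ℬ).glue_condition f g).symm⟩, ⟨(projGlueData ℬ).vPullbackConeIsLimit f g⟩⟩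

theorem projOpen_mono {A B : Set S} (h : A ⊆ B) : projOpen ℬ A ≤ projOpen ℬ B :=
  iSup₂_le fun f hf => le_iSup₂ (f := fun (f : Rel ℬ) (_ : (f : S) ∈ B) => (projι f).opensRange)
    f (h hf)

/-- If some power of the relevant element `f` lies in the ideal generated by a set `G` of relevant
elements, then `Spec S_(f)` is contained in the union of the `Spec S_(g)`, `g ∈ G`. -/
theorem opensRange_projι_le (f : Rel ℬ) {G : Set S} (hG : ∀ g ∈ G, IsRelevant ℬ g)
    (hf : (f : S) ∈ (Ideal.span G).radical) : (projι f).opensRange ≤ projOpen ℬ G := by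
  obtain ⟨n, hn⟩ := hf
  obtain ⟨d, hd⟩ := f.hom
  rintro _ ⟨p, rfl⟩
  -- Such a fraction puts the point in `Spec S_(fag)`, which lies in `Spec S_(fg)` and hence in
  -- `Spec S_(g)`.
  suffices ∃ g ∈ G, ∃ a : S, ∃ h : a * g ∈ ℬ (n • d), SetLike.IsHomogeneousElem ℬ a ∧
      HomogeneousLocalization.Away.mk ℬ hd n (a * g) h ∉ p.asIdeal by
    obtain ⟨g, hg, a, h, ha, hp⟩ := this
    have hk : SetLike.IsHomogeneousElem ℬ (a * g) := ⟨_, h⟩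
    have hp' : p ∈ Set.range (specDvd ℬ (.mul_right (f : S) hk)) := by
      rw [range_specDvd_mul hd h]
      exact hp
    obtain ⟨q, hq⟩ := hp'
    let g' : Rel ℬ := ⟨g, hG g hg⟩
    have hfg : HomDvd ℬ (f * g : S) (f * (a * g)) := ⟨a, ha, by ring⟩
    have e1 : specDvd ℬ (.mul_right (f : S) hk) =
        specDvd ℬ hfg ≫ specDvd ℬ (.mul_right (f : S) g'.hom) :=
      (specDvd_specDvd _ _ f.hom).symm
    refine TopologicalSpace.Opens.mem_iSup.mpr ⟨g', TopologicalSpace.Opens.mem_iSup.mpr ⟨hg, ?_⟩⟩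
    refine ⟨specDvd ℬ (.mul_left f.hom g) (specDvd ℬ hfg q), ?_⟩
    rw [← hq, e1]
    simp only [← Scheme.Hom.comp_apply, Category.assoc]
    rw [specDvd_projι f g' _ (.mul_left f.hom g)]
  -- If all these fractions lie in `p`, then so does the degree `n • d` part of every element of the
  -- ideal, divided by `f ^ n`. Taking `f ^ n` as the element gives `1 ∈ p`.
  by_contra! hc
  have key : ∀ x ∈ Ideal.span G, HomogeneousLocalization.Away.mk ℬ hd n
      (DirectSum.decompose ℬ x (n • d) : S) (SetLike.coe_mem _) ∈ p.asIdeal := by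
    intro x hx
    induction hx using Submodule.closure_induction with
    | zero =>
      convert! zero_mem p.asIdeal
      ext
      simp [HomogeneousLocalization.Away.val_mk, Localization.mk_zero]
    | add x y _ _ hx hy =>
      convert! add_mem hx hy
      ext
      simp [HomogeneousLocalization.Away.val_mk, Localization.add_mk_self]
    | smul_mem a g hg =>
      obtain ⟨e, he⟩ := (hG g hg).1
      -- As `g` is homogeneous of degree `e`, only the degree `n • d - e` part of `a` contributes.
      have e1 : (DirectSum.decompose ℬ (a • g) (n • d) : S) =
          (DirectSum.decompose ℬ a (n • d - e) : S) * g := by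
        rw [smul_eq_mul, ← DirectSum.coe_decompose_mul_add_of_right_mem ℬ he, sub_add_cancel]
      have := hc g hg (DirectSum.decompose ℬ a (n • d - e) : S) (e1 ▸ SetLike.coe_mem _)
        ⟨_, SetLike.coe_mem _⟩
      convert! this using 1
      ext
      simp only [HomogeneousLocalization.Away.val_mk, e1]
  have h1 := key _ hn
  refine p.2.ne_top ((Ideal.eq_top_iff_one _).mpr ?_)
  convert! h1
  ext
  simp only [HomogeneousLocalization.val_one, HomogeneousLocalization.Away.val_mk,
    DirectSum.decompose_of_mem_same ℬ (SetLike.pow_mem_graded n hd)]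
  exact (Localization.mk_self (⟨(f : S) ^ n, n, rfl⟩ : Submonoid.powers (f : S))).symm

theorem projOpen_le_of_le_radical {A G : Set S} (hG : ∀ g ∈ G, IsRelevant ℬ g)
    (h : ∀ f ∈ A, IsRelevant ℬ f → f ∈ (Ideal.span G).radical) : projOpen ℬ A ≤ projOpen ℬ G :=
  iSup₂_le fun f hf => opensRange_projι_le f hG (h f hf f.2)

/-! ### Charts of open unions, and gluing of morphisms. -/

theorem chart_ι (A : Set S) (f : S) (hr : IsRelevant ℬ f) (hA : f ∈ A) :
    chart ℬ A f hr hA ≫ (projOpen ℬ A).ι = projι ⟨f, hr⟩ :=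
  IsOpenImmersion.lift_fac _ _ _

theorem isOpenImmersion_chart (A : Set S) (f : S) (hr : IsRelevant ℬ f) (hA : f ∈ A) :
    IsOpenImmersion (chart ℬ A f hr hA) := by
  have : IsOpenImmersion (chart ℬ A f hr hA ≫ (projOpen ℬ A).ι) := by
    rw [chart_ι]; infer_instance
  exact IsOpenImmersion.of_comp _ (projOpen ℬ A).ι

theorem mem_range_chart (A : Set S) (f : S) (hr : IsRelevant ℬ f) (hA : f ∈ A)
    {x : (projOpen ℬ A).toScheme} (hx : (projOpen ℬ A).ι x ∈ (projι ⟨f, hr⟩).opensRange) :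
    x ∈ Set.range (chart ℬ A f hr hA) := by
  obtain ⟨y, hy⟩ := hx
  refine ⟨y, (projOpen ℬ A).ι.isOpenEmbedding.injective ?_⟩
  rw [← hy, ← Scheme.Hom.comp_apply, chart_ι]

/-- If `Spec S_(f)`, `f ∈ G`, cover the union over `A ⊇ G`, then the corresponding charts do. -/
theorem exists_mem_range_chart {A G : Set S} (hGA : G ⊆ A) (h : projOpen ℬ A ≤ projOpen ℬ G)
    (x : (projOpen ℬ A).toScheme) :
    ∃ (f : S) (hr : IsRelevant ℬ f) (hf : f ∈ G), x ∈ Set.range (chart ℬ A f hr (hGA hf)) := by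
  have hx : (projOpen ℬ A).ι x ∈ projOpen ℬ G := h x.2
  obtain ⟨f, hf⟩ := TopologicalSpace.Opens.mem_iSup.mp hx
  obtain ⟨hf, hx⟩ := TopologicalSpace.Opens.mem_iSup.mp hf
  exact ⟨f, f.2, hf, mem_range_chart A f f.2 (hGA hf) hx⟩

/-- The inclusion of the open union into Proj is a monomorphism, so fibre products over the two
schemes agree. -/
theorem isPullback_chart (A : Set S) {f g : S} (hf : IsRelevant ℬ f) (hg : IsRelevant ℬ g)
    (hfA : f ∈ A) (hgA : g ∈ A) (h : HomDvd ℬ f (f * g)) (h' : HomDvd ℬ g (f * g)) :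
    IsPullback (specDvd ℬ h) (specDvd ℬ h') (chart ℬ A f hf hfA) (chart ℬ A g hg hgA) := by
  have := isPullback_projι (⟨f, hf⟩ : Rel ℬ) ⟨g, hg⟩ h h'
  rw [← chart_ι A f hf hfA, ← chart_ι A g hg hgA] at this
  have hw : specDvd ℬ h ≫ chart ℬ A f hf hfA = specDvd ℬ h' ≫ chart ℬ A g hg hgA := by
    rw [← cancel_mono (projOpen ℬ A).ι, Category.assoc, Category.assoc]
    exact this.w
  refine ⟨⟨hw⟩, ⟨PullbackCone.IsLimit.mk hw (fun s => this.lift s.fst s.snd ?_)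
    (fun s => this.lift_fst _ _ _) (fun s => this.lift_snd _ _ _) fun s m h1 h2 =>
      this.hom_ext (by simpa using h1) (by simpa using h2)⟩⟩
  rw [← Category.assoc, ← Category.assoc, s.condition]

/-- Gluing of morphisms on the charts `Spec S_(t i)`. -/
theorem existsUnique_glue {A : Set S} {I : Type u} (t : I → S) (hr : ∀ i, IsRelevant ℬ (t i))
    (hA : ∀ i, t i ∈ A) (hcov : projOpen ℬ A ≤ projOpen ℬ (Set.range t)) {Z : Scheme.{u}}
    (v : ∀ i, specAway ℬ (t i) ⟶ Z)
    (hv : ∀ i j, specDvd ℬ (.mul_right (t i) (hr j).1) ≫ v i =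
      specDvd ℬ (.mul_left (hr i).1 (t j)) ≫ v j) :
    ∃! h : (projOpen ℬ A).toScheme ⟶ Z, ∀ i, chart ℬ A (t i) (hr i) (hA i) ≫ h = v i := by
  -- The cover is indexed by `I`, not by the elements `t i`, so `t` need not be injective and one
  -- chart may occur several times.
  let 𝒰 : (projOpen ℬ A).toScheme.OpenCover :=
    Scheme.Cover.mkOfCovers I (fun i => specAway ℬ (t i))
      (fun i => chart ℬ A (t i) (hr i) (hA i))
      (fun x => by
        obtain ⟨_, _, ⟨i, rfl⟩, y, hy⟩ :=
          exists_mem_range_chart (by rintro _ ⟨i, rfl⟩; exact hA i) hcov x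
        exact ⟨i, y, hy⟩)
      (fun i => isOpenImmersion_chart A (t i) (hr i) (hA i))
  have hc : ∀ i j, pullback.fst (𝒰.f i) (𝒰.f j) ≫ v i = pullback.snd (𝒰.f i) (𝒰.f j) ≫ v j := by
    intro (i : I) (j : I)
    change pullback.fst (chart ℬ A (t i) (hr i) (hA i)) (chart ℬ A (t j) (hr j) (hA j)) ≫ v i =
      pullback.snd _ _ ≫ v j
    have hp := isPullback_chart A (hr i) (hr j) (hA i) (hA j)
      (.mul_right (t i) (hr j).1) (.mul_left (hr i).1 (t j))
    -- Pulling back along the isomorphism from `Spec S_(t i * t j)` turns the gluing condition into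
    -- `hv`.
    rw [← cancel_epi hp.isoPullback.hom]
    exact (hp.isoPullback_hom_fst_assoc _).trans
      ((hv i j).trans (hp.isoPullback_hom_snd_assoc _).symm)
  exact ⟨𝒰.glueMorphisms v hc, fun i => 𝒰.ι_glueMorphisms v hc i, fun h' hh' =>
    𝒰.hom_ext _ _ fun i => (hh' i).trans (𝒰.ι_glueMorphisms v hc i).symm⟩

end Graded

end MultiProj

namespace MultiProj

/-! ### Induced maps on degree-zero localizations. -/

namespace MultigradedHom

variable {R S T : MultigradedRing.{u}}

theorem away_mk (φ : MultigradedHom R S) {g : R.Carrier} {d : R.Deg} (hg : g ∈ R.piece d) (n : ℕ)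
    (a : R.Carrier) (ha : a ∈ R.piece (n • d)) :
    φ.away g (HomogeneousLocalization.Away.mk R.piece hg n a ha) =
      HomogeneousLocalization.Away.mk S.piece (φ.map_mem d g hg) n (φ.toRingHom a)
        (by rw [← map_nsmul]; exact φ.map_mem _ _ ha) := by
  ext
  rw [HomogeneousLocalization.Away.val_mk]
  change Localization.mk (φ.toRingHom a) ⟨φ.toRingHom (g ^ n), _⟩ = _
  congr 2
  exact map_pow _ _ _

theorem away_comp_awayDvd (φ : MultigradedHom R S) {g x : R.Carrier} (hg : SetLike.IsHomogeneousElem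
    R.piece g) (h : HomDvd R.piece g x) (h' : HomDvd S.piece (φ.toRingHom g) (φ.toRingHom x)) :
    (φ.away x).comp (awayDvd R.piece h) = (awayDvd S.piece h').comp (φ.away g) := by
  obtain ⟨d, hd⟩ := hg
  obtain ⟨k, ⟨e, hk⟩, rfl⟩ := id h
  rw [awayDvd_eq h hk rfl, awayDvd_eq h' (φ.map_mem e k hk) (map_mul _ _ _)]
  refine RingHom.ext fun a => ?_
  obtain ⟨n, s, hs, rfl⟩ := HomogeneousLocalization.Away.mk_surjective R.piece hd a
  simp only [RingHom.comp_apply, HomogeneousLocalization.awayMap_mk, away_mk]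
  ext
  simp only [HomogeneousLocalization.Away.val_mk, map_mul, map_pow]

/-- `R_(gg') → S_(φ(g)φ(g'))` extends both `R_(g) → S_(φ(g))` and `R_(g') → S_(φ(g'))`. -/
theorem exists_common_extension (φ : MultigradedHom R S) {g g' : R.Carrier}
    (hg : SetLike.IsHomogeneousElem R.piece g) (hg' : SetLike.IsHomogeneousElem R.piece g')
    {y : S.Carrier} (hy : φ.toRingHom (g * g') = y) (h : HomDvd S.piece (φ.toRingHom g) y)
    (h' : HomDvd S.piece (φ.toRingHom g') y) :
    ∃ ψ : HomogeneousLocalization.Away R.piece (g * g') →+* HomogeneousLocalization.Away S.piece y,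
      ψ.comp (awayDvd R.piece (.mul_right g hg')) = (awayDvd S.piece h).comp (φ.away g) ∧
      ψ.comp (awayDvd R.piece (.mul_left hg g')) = (awayDvd S.piece h').comp (φ.away g') := by
  subst hy
  exact ⟨φ.away (g * g'), φ.away_comp_awayDvd hg _ _, φ.away_comp_awayDvd hg' _ _⟩

/-- The inclusion of `φ(R)` in `S` keeps the grading group `D_S`, so relevance in the subring passes
to `S`. Relevance of `g` in `R` alone would not suffice, since the image of `D_R` may have infinite
index in `D_S`. -/
theorem isRelevant_of_mem_ratLocus (φ : MultigradedHom R S) {g : R.Carrier} (hg : g ∈ φ.ratLocus) :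
    IsRelevant S.piece (φ.toRingHom g) :=
  IsRelevant.map (𝒜 := φ.imagePiece) φ.toRingHom.range.subtype (fun _ _ h => h) hg.2

end MultigradedHom

/-! ### Morphisms into `Proj_B` and functoriality. -/

namespace ConicalRing

open HomogeneousLocalization

variable {X Y Z : ConicalRing.{u}}

/-- Both composites factor through the overlap `Spec R_(gg')` by way of `ψ`, and the two charts
agree there. -/
theorem spec_comp_projChart_eq {g g' : X.Carrier} (hg : g ∈ X.relB) (hg' : g' ∈ X.relB)
    {T : Type u} [CommRing T] (a : Away X.piece g →+* T) (b : Away X.piece g' →+* T)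
    (ψ : Away X.piece (g * g') →+* T)
    (ha : ψ.comp (awayDvd X.piece (.mul_right g hg'.1.1)) = a)
    (hb : ψ.comp (awayDvd X.piece (.mul_left hg.1.1 g')) = b) :
    Spec.map (CommRingCat.ofHom a) ≫ X.projChart g hg =
      Spec.map (CommRingCat.ofHom b) ≫ X.projChart g' hg' := by
  subst ha hb
  rw [CommRingCat.ofHom_comp, CommRingCat.ofHom_comp, Spec.map_comp, Spec.map_comp, Category.assoc,
    Category.assoc]
  congr 1
  exact (isPullback_chart X.relB hg.1 hg'.1 hg hg' _ _).w

theorem existsUnique_glue_localMap {A : Set Y.Carrier} {I : Type u} (s : I → X.Carrier)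
    (hs : ∀ i, s i ∈ X.relB) (t : I → Y.Carrier)
    (hr : ∀ i, IsRelevant Y.piece (t i)) (hA : ∀ i, t i ∈ A)
    (hcov : projOpen Y.piece A ≤ projOpen Y.piece (Set.range t))
    (θ : ∀ i, Away X.piece (s i) →+* Away Y.piece (t i))
    (hθ : ∀ i j, ∃ ψ : Away X.piece (s i * s j) →+* Away Y.piece (t i * t j),
      ψ.comp (awayDvd X.piece (.mul_right (s i) (hs j).1.1)) =
          (awayDvd Y.piece (.mul_right (t i) (hr j).1)).comp (θ i) ∧
        ψ.comp (awayDvd X.piece (.mul_left (hs i).1.1 (s j))) =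
          (awayDvd Y.piece (.mul_left (hr i).1 (t j))).comp (θ j)) :
    ∃! h : (projOpen Y.piece A).toScheme ⟶ X.Proj, ∀ i,
      chart Y.piece A (t i) (hr i) (hA i) ≫ h =
        Spec.map (CommRingCat.ofHom (θ i)) ≫ X.projChart (s i) (hs i) := by
  refine existsUnique_glue t hr hA hcov _ fun i j => ?_
  obtain ⟨ψ, h1, h2⟩ := hθ i j
  have := spec_comp_projChart_eq (hs i) (hs j) _ _ ψ h1 h2
  rw [CommRingCat.ofHom_comp, CommRingCat.ofHom_comp, Spec.map_comp, Spec.map_comp, Category.assoc,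
    Category.assoc] at this
  exact this

theorem Proj.hom_ext {W : Scheme.{u}} {h₁ h₂ : X.Proj ⟶ W}
    (h : ∀ (f : X.Carrier) (hf : f ∈ X.relB), X.projChart f hf ≫ h₁ = X.projChart f hf ≫ h₂) :
    h₁ = h₂ := by
  refine (existsUnique_glue (A := X.relB) (fun f : X.relB => (f : X.Carrier)) (fun f => f.2.1)
    (fun f => f.2) (projOpen_mono (by simp)) (fun f => X.projChart f f.2 ≫ h₂)
    fun f g => ?_).unique (fun f => h f f.2) (fun f => rfl)
  rw [← Category.assoc, ← Category.assoc]
  congr 1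
  exact (isPullback_chart X.relB f.2.1 g.2.1 f.2 g.2 _ _).w

theorem existsUnique_projMap (Φ : X ⟶ Y) :
    ∃! h : Y.Proj ⟶ X.Proj,
      ∀ i : {g : X.Carrier // g ∈ X.relB ∧ Φ.toRingHom g ∈ Y.relB},
        Y.projChart (Φ.toRingHom i) i.2.2 ≫ h =
          Spec.map (CommRingCat.ofHom (Φ.away i)) ≫ X.projChart i i.2.1 := by
  refine existsUnique_glue_localMap (A := Y.relB)
    (I := {g : X.Carrier // g ∈ X.relB ∧ Φ.toRingHom g ∈ Y.relB}) (fun i => i.1) (fun i => i.2.1)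
    (fun i => Φ.toRingHom i.1) (fun i => i.2.2.1) (fun i => i.2.2) (projOpen_mono ?_)
    (fun i => Φ.away i.1) fun i j => Φ.exists_common_extension i.2.1.1.1 j.2.1.1.1 (map_mul _ _ _) _ _
  -- The chosen charts cover because every `B_S`-relevant element is the image of a `B_R`-relevant
  -- one.
  intro f hf
  obtain ⟨-, g, hg, rfl⟩ := Φ.relevant ▸ hf
  exact ⟨⟨g, hg, hf⟩, rfl⟩

/-- The morphism of schemes `Proj_{B_S}(S) → Proj_{B_R}(R)` induced by a morphism of conical
rings. -/
noncomputable def projMap (Φ : X ⟶ Y) : Y.Proj ⟶ X.Proj :=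
  (existsUnique_projMap Φ).choose

theorem projChart_projMap (Φ : X ⟶ Y) {g : X.Carrier} (hg : g ∈ X.relB)
    (hf : Φ.toRingHom g ∈ Y.relB) : Y.projChart (Φ.toRingHom g) hf ≫ projMap Φ =
      Spec.map (CommRingCat.ofHom (Φ.away g)) ≫ X.projChart g hg :=
  (existsUnique_projMap Φ).choose_spec.1 ⟨g, hg, hf⟩

theorem id_away (X : ConicalRing.{u}) (g : X.Carrier) : (𝟙 X : X ⟶ X).away g = RingHom.id _ := by
  refine RingHom.ext fun a => ?_
  induction a using Quotient.inductionOn'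
  rfl

theorem comp_away (Φ : X ⟶ Y) (Ψ : Y ⟶ Z) (g : X.Carrier) :
    (Φ ≫ Ψ).away g = (Ψ.away (Φ.toRingHom g)).comp (Φ.away g) := by
  refine RingHom.ext fun a => ?_
  induction a using Quotient.inductionOn'
  rfl

theorem projMap_id (X : ConicalRing.{u}) : projMap (𝟙 X) = 𝟙 X.Proj := by
  refine Proj.hom_ext fun f hf => ?_
  refine (projChart_projMap (𝟙 X) hf hf).trans ?_
  rw [id_away]
  exact (congrArg (· ≫ X.projChart f hf) (Spec.map_id _)).trans
    ((Category.id_comp _).trans (Category.comp_id _).symm)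

theorem projMap_comp (Φ : X ⟶ Y) (Ψ : Y ⟶ Z) : projMap (Φ ≫ Ψ) = projMap Ψ ≫ projMap Φ := by
  refine Proj.hom_ext fun f hf => ?_
  -- Lifting twice makes every chart of the source the chart of some `Ψ(Φ(k))` with `Φ(k)` relevant
  -- in between, so the two chart formulas compose.
  obtain ⟨-, g, hg, rfl⟩ := Ψ.relevant ▸ hf
  obtain ⟨-, k, hk, rfl⟩ := Φ.relevant ▸ hg
  rw [← Category.assoc, projChart_projMap Ψ hg hf, Category.assoc, projChart_projMap Φ hk hg]
  refine (projChart_projMap (Φ ≫ Ψ) hk hf).trans ?_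
  rw [comp_away, CommRingCat.ofHom_comp, Spec.map_comp, Category.assoc]

/-- The contravariant functor `(S, B) ↦ Proj_B(S)`. -/
noncomputable def projFunctor : ConicalRing.{u}ᵒᵖ ⥤ Scheme.{u} where
  obj X := X.unop.Proj
  map Φ := projMap Φ.unop
  map_id X := projMap_id X.unop
  map_comp Φ Ψ := projMap_comp Ψ.unop Φ.unop

/-! ### Ideals generated by relevant elements. -/

/-- A homogeneous `b ∈ B` is a combination of relevant elements `x`, because `B ⊆ S_+`. Each `x * b`
is relevant and lies in `B`, so multiplying the combination by `b` shows that `b ^ 2` is in the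
ideal. -/
theorem B_le_radical (X : ConicalRing.{u}) : X.B ≤ (Ideal.span X.relB).radical := by
  rw [← X.homogeneous_B.toIdeal_homogeneousCore_eq_self]
  refine Ideal.span_le.mpr ?_
  rintro _ ⟨⟨b, hb⟩, hbB, rfl⟩
  refine ⟨2, ?_⟩
  change b ^ 2 ∈ _
  have key : ∀ x ∈ irrelevantIdeal X.piece, x * b ∈ Ideal.span X.relB := by
    intro x hx
    induction hx using Submodule.span_induction with
    | zero => simp
    | add x y _ _ hx hy => rw [add_mul]; exact add_mem hx hy
    | smul a x _ hx => rw [smul_mul_assoc]; exact Submodule.smul_mem _ a hx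
    | mem x hx => exact Ideal.subset_span ⟨hx.mul_right hb, X.B.mul_mem_left x hbB⟩
  rw [pow_two]
  exact key b (X.B_le hbB)

theorem map_B_le_radical (φ : MultigradedHom X.toMultigradedRing Y.toMultigradedRing) :
    Ideal.map φ.toRingHom X.B ≤ (Ideal.span (φ.toRingHom '' X.relB)).radical := by
  rw [← Ideal.map_span]
  exact (Ideal.map_mono X.B_le_radical).trans (Ideal.map_radical_le _)

theorem exists_isMinimalGeneratingSystem (X : ConicalRing.{u}) (hX : IsFactoriallyGraded X.piece)
    [IsNoetherianRing X.Carrier] : ∃ G : Set X.Carrier, X.IsMinimalGeneratingSystem G ∧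
      ∀ f ∈ G, ∃ s : Multiset X.Carrier, (∀ p ∈ s, IsGradedPrime X.piece p) ∧ s.prod = f := by
  cases subsingleton_or_nontrivial X.Carrier with
  | inl _ =>
    -- Over the zero ring `{1}` would not be minimal, since the empty set already generates.
    exact ⟨∅, ⟨Set.empty_subset _, Subsingleton.elim _ _, fun G' h _ => Set.subset_empty_iff.mp h⟩,
      fun f hf => hf.elim⟩
  | inr _ =>
    by_cases hu : ∃ u ∈ X.relB, IsUnit u
    · obtain ⟨u, hu, hu'⟩ := hu
      have htop : Ideal.span X.relB = ⊤ :=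
        Ideal.eq_top_of_isUnit_mem _ (Ideal.subset_span hu) hu'
      refine ⟨{1}, ⟨?_, ?_, fun G' h hG' => ?_⟩, ?_⟩
      · rintro _ rfl
        exact ⟨hu.1.one_of_isUnit hu', (Ideal.eq_top_iff_one _).mp (X.B.eq_top_of_isUnit_mem hu.2 hu')⟩
      · rw [htop, Ideal.span_singleton_one]
      · refine (Set.subset_singleton_iff_eq.mp h).resolve_left fun h0 => ?_
        rw [h0, Ideal.span_empty, htop] at hG'
        exact bot_ne_top hG'
      · rintro _ rfl
        -- `1` is the empty product of primes.
        exact ⟨0, by simp, by simp⟩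
    · push Not at hu
      -- The element `0` is relevant, as the localization at `0` is the zero ring, where `0` is a
      -- unit of every degree. It has to be discarded because it has no prime factorization.
      have h0 : Ideal.span (X.relB \ {0}) = Ideal.span X.relB := Ideal.span_sdiff_singleton_zero
      have hfg : (Ideal.span (X.relB \ {0})).FG := IsNoetherian.noetherian _
      obtain ⟨s, hs, hspan⟩ := Submodule.fg_span_iff_fg_span_finset_subset _ |>.mp hfg
      obtain ⟨G, ⟨hG, hGspan⟩, hmin⟩ := exists_minimal_of_wellFoundedLT
        (fun G : Finset X.Carrier => (G : Set X.Carrier) ⊆ X.relB \ {0} ∧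
          Ideal.span (G : Set X.Carrier) = Ideal.span X.relB) ⟨s, hs, hspan.symm.trans h0⟩
      refine ⟨G, ⟨hG.trans Set.sdiff_subset, hGspan, fun G' h hG' => ?_⟩, fun f hf =>
        hX.2 f (hG hf).1.1.1 (hG hf).2 (hu f (hG hf).1)⟩
      -- Minimality among finite generating sets is enough, since subsets of a finite set are
      -- finite.
      obtain ⟨G', rfl⟩ := (G.finite_toSet.subset h).exists_finset_coe
      exact h.antisymm (hmin ⟨h.trans hG, hG'⟩ h)

end ConicalRing

end MultiProj

/-! ### The proposition. -/

theorem mainTheorem12 :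
    -- each `Proj^D_B(S)` is covered by the open `Spec S_(f)`, which meet in `Spec S_(fg)`
    (∀ X : ConicalRing.{u},
      (∀ (f : X.Carrier) (hf : f ∈ X.relB), IsOpenImmersion (X.projChart f hf)) ∧
      (∀ x : X.Proj, ∃ (f : X.Carrier) (hf : f ∈ X.relB), x ∈ Set.range (X.projChart f hf)) ∧
      (∀ (f g : X.Carrier) (hf : f ∈ X.relB) (hg : g ∈ X.relB),
        IsPullback (specDvd X.piece (.mul_right f hg.1.1)) (specDvd X.piece (.mul_left hf.1.1 g))
          (X.projChart f hf) (X.projChart g hg))) ∧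
    -- the union may be taken over any generating system of `B`-relevant elements
    (∀ (X : ConicalRing.{u}) (G : Set X.Carrier), G ⊆ X.relB →
      Ideal.span G = Ideal.span X.relB → projOpen X.piece G = projOpen X.piece X.relB) ∧
    (∀ X : ConicalRing.{u}, IsFactoriallyGraded X.piece → IsNoetherianRing X.Carrier →
      ∃ G : Set X.Carrier, X.IsMinimalGeneratingSystem G ∧
        ∀ f ∈ G, ∃ s : Multiset X.Carrier, (∀ p ∈ s, IsGradedPrime X.piece p) ∧ s.prod = f) ∧
    -- functoriality
    (∃ (F : ConicalRing.{u}ᵒᵖ ⥤ Scheme.{u}) (hF : ∀ X, F.obj (.op X) = X.Proj),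
      ∀ (X Y : ConicalRing.{u}) (Φ : X ⟶ Y) (g : X.Carrier) (hg : g ∈ X.relB)
        (hf : Φ.toRingHom g ∈ Y.relB),
        Y.projChart (Φ.toRingHom g) hf ≫ eqToHom (hF Y).symm ≫ F.map Φ.op ≫ eqToHom (hF X) =
          Spec.map (CommRingCat.ofHom (Φ.away g)) ≫ X.projChart g hg) ∧
    -- rationally relevant morphisms
    (∀ (X Y : ConicalRing.{u}) (φ : MultigradedHom X.toMultigradedRing Y.toMultigradedRing),
      X.IsRationallyRelevant φ →
      ∃ hrel : ∀ g ∈ X.relB, IsRelevant Y.piece (φ.toRingHom g),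
        (∃! h : (projOpen Y.piece (φ.toRingHom '' X.relB)).toScheme ⟶ X.Proj,
          ∀ (g : X.Carrier) (hg : g ∈ X.relB),
            chart Y.piece (φ.toRingHom '' X.relB) (φ.toRingHom g) (hrel g hg) ⟨g, hg, rfl⟩ ≫ h =
              Spec.map (CommRingCat.ofHom (φ.away g)) ≫ X.projChart g hg) ∧
        (Y.B = Ideal.map φ.toRingHom X.B →
          projOpen Y.piece (φ.toRingHom '' X.relB) = projOpen Y.piece Y.relB ∧
          ∃ hmem : ∀ g ∈ X.relB, φ.toRingHom g ∈ Y.relB,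
            ∃! h : Y.Proj ⟶ X.Proj, ∀ (g : X.Carrier) (hg : g ∈ X.relB),
              Y.projChart (φ.toRingHom g) (hmem g hg) ≫ h =
                Spec.map (CommRingCat.ofHom (φ.away g)) ≫ X.projChart g hg)) ∧
    -- rational maps
    (∀ (X Y : ConicalRing.{u}) (Φ : RationalMap X Y),
      projOpen Y.piece (Set.range Φ.target) ≤ projOpen Y.piece Y.relB ∧
      ∃! h : (projOpen Y.piece (Set.range Φ.target)).toScheme ⟶ X.Proj, ∀ g : X.relB,
        chart Y.piece (Set.range Φ.target) (Φ.target g) (Φ.target_mem g).1 ⟨g, rfl⟩ ≫ h =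
          Spec.map (CommRingCat.ofHom (Φ.localMap g)) ≫ X.projChart g g.2) := by
  refine ⟨fun X => ⟨fun f hf => isOpenImmersion_chart _ f hf.1 hf, fun x => ?_,
      fun f g hf hg => isPullback_chart X.relB hf.1 hg.1 hf hg _ _⟩, fun X G hG hspan => ?_,
    fun X hX _ => X.exists_isMinimalGeneratingSystem hX, ?_, ?_, ?_⟩
  · obtain ⟨f, _, hf, hx⟩ := exists_mem_range_chart subset_rfl le_rfl x
    exact ⟨f, hf, hx⟩
  · refine le_antisymm (projOpen_mono hG) (projOpen_le_of_le_radical (fun g hg => (hG hg).1) ?_)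
    exact fun f hf _ => Ideal.le_radical (hspan ▸ Ideal.subset_span hf)
  · refine ⟨ConicalRing.projFunctor, fun X => rfl, fun X Y Φ g hg hf => ?_⟩
    exact (congrArg _ ((Category.id_comp _).trans (Category.comp_id _))).trans
      (ConicalRing.projChart_projMap Φ hg hf)
  · intro X Y φ hφ
    have hrel : ∀ g ∈ X.relB, IsRelevant Y.piece (φ.toRingHom g) :=
      fun g hg => φ.isRelevant_of_mem_ratLocus (hφ hg)
    have hrange : φ.toRingHom '' X.relB = Set.range fun g : X.relB => φ.toRingHom g :=
      Set.image_eq_range _ _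
    -- The source is left open so that the same gluing serves the union over `φ(Rel)` and
    -- `Proj_{B_S}(S)`.
    have hglue := fun (A : Set Y.Carrier) (hA : ∀ g : X.relB, φ.toRingHom g ∈ A)
        (hcov : projOpen Y.piece A ≤ projOpen Y.piece (φ.toRingHom '' X.relB)) =>
      ConicalRing.existsUnique_glue_localMap (fun g : X.relB => (g : X.Carrier)) (fun g => g.2)
        (fun g => φ.toRingHom g) (fun g => hrel g g.2) hA (hrange ▸ hcov) (fun g => φ.away g)
        fun g g' => φ.exists_common_extension g.2.1.1 g'.2.1.1 (map_mul _ _ _) _ _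
    refine ⟨hrel, ?_, fun hB => ?_⟩
    · obtain ⟨h, hh, hu⟩ := hglue (φ.toRingHom '' X.relB) (fun g => ⟨g, g.2, rfl⟩) le_rfl
      exact ⟨h, fun g hg => hh ⟨g, hg⟩, fun h' hh' => hu h' fun g => hh' g g.2⟩
    · have hmem : ∀ g ∈ X.relB, φ.toRingHom g ∈ Y.relB :=
        fun g hg => ⟨hrel g hg, hB ▸ Ideal.mem_map_of_mem _ hg.2⟩
      -- A `B_S`-relevant element need not be an image of a relevant one; it only lies in the
      -- radical of the ideal generated by such images, which is enough for covering.
      have hle : projOpen Y.piece Y.relB ≤ projOpen Y.piece (φ.toRingHom '' X.relB) := by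
        refine projOpen_le_of_le_radical (by rintro _ ⟨g, hg, rfl⟩; exact hrel g hg) ?_
        exact fun f hf _ => ConicalRing.map_B_le_radical φ (hB ▸ hf.2)
      refine ⟨le_antisymm (projOpen_mono (by rintro _ ⟨g, hg, rfl⟩; exact hmem g hg)) hle, hmem, ?_⟩
      obtain ⟨h, hh, hu⟩ := hglue Y.relB (fun g => hmem g g.2) hle
      exact ⟨h, fun g hg => hh ⟨g, hg⟩, fun h' hh' => hu h' fun g => hh' g g.2⟩
  · intro X Y Φ
    exact ⟨projOpen_mono (by rintro _ ⟨g, rfl⟩; exact Φ.target_mem g),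
      ConicalRing.existsUnique_glue_localMap (A := Set.range Φ.target)
        (fun g : X.relB => (g : X.Carrier)) (fun g => g.2) Φ.target
        (fun g => (Φ.target_mem g).1) (fun g => ⟨g, rfl⟩) le_rfl Φ.localMap Φ.compatible⟩
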